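/- Write $\mathbb D=\{z\in\mathbb C:|z|<1\}$ and ${}_2F_1(a,b;c;z)=\sum_{n\ge0}\frac{(a)_n(b)_n}{(c)_n\,n!}z^n$ for $z\in\mathbb D$, where $(x)_0=1$ and $(x)_n=x(x+1)\cdots(x+n-1)$. "Univalent" means analytic and injective. For functions $g,h$ on $\mathbb D$, $g\prec h$ means that $g=h\circ\omega$ on $\mathbb D$ for some analytic $\omega$ on $\mathbb D$ with $|\omega(z)|\le|z|$. For $\varphi$ analytic on $\mathbb D$ with $\varphi(0)=1$, let $\mathcal S^*(\varphi)$ be the set of analytic $f$ on $\mathbb D$ with $f(0)=0$, $f'(0)=1$, $f(z)\ne0$ for $0<|z|<1$, and $zf'/f\prec\varphi$ (where $zf'/f$ takes the value $1$ at $z=0$). Let $\mathcal Q$ be the set of all analytic functions $Q$ for which there exist finitely many points $\zeta_1,\dots,\zeta_n\in\partial\mathbb D$ such that: 1. $Q$ is analytic and univalent on a neighbourhood of $\overline{\mathbb D}\setminus\{\zeta_1,\dots,\zeta_n\}$; 2. $Q(0)=0$; 3. for each $j$, $Q(z)$ has a limit $w_j\in\mathbb C\cup\{\infty\}$ as $z\to\zeta_j$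 in $\mathbb D$; 4. if $w_j\in\mathbb C$, then for some real $\beta_j>1$ a branch of $(Q(z)-w_j)^{\beta_j}$, defined for $z\in\mathbb D$ near $\zeta_j$, extends to a univalent function on a neighbourhood of $\zeta_j$; 5. if $w_j=\infty$, then for some real $\beta_j\ge1$ a branch of $Q(z)^{-\beta_j}$, defined for $z\in\mathbb D$ near $\zeta_j$, extends to a univalent function on a neighbourhood of $\zeta_j$; 6. if $w_j=\infty$ and $\beta_j=1$, then the (extended) function $P=1/Q$ satisfies $\zeta_jP'(\zeta_j)\in\mathbb C\setminus[0,1]$. **Theorem.** Let $a,b,c\in\mathbb C$ with $c\ne0,-1,-2,\dots$, and let $\varphi=1+Q$ for some $Q\in\mathcal Q$, with exceptional points $\zeta_1,\dots,\zeta_n$ as above. Put $p=a+b+1-c$, $A=Q\,(Q+c-1)$ and $B=(Q+a)(Q+b)$. If $$0<-2\,\mathrm{Re}\big[(pQ(\zeta)+ab)\,\overline{\zeta Q'(\zeta)}\big] \quad\text{and}\quad |B(\zeta)|^2-|A(\zeta)|^2\le-2\,\mathrm{Re}\big[(pQ(\zeta)+ab)\,\overline{\zeta Q'(\zeta)}\big]$$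 for all $\zeta\in\partial\mathbb D\setminus\{\zeta_1,\dots,\zeta_n\}$, then the function $f(z)=z\,{}_2F_1(a,b;c;z)$ belongs to $\mathcal S^*(\varphi)$. -/

import Mathlib

open scoped ComplexConjugate

namespace ShiftedGauss

/-- The open unit disk. -/
abbrev unitDisk : Set ℂ := Metric.ball 0 1

/-- `f` is analytic and univalent (injective) on the set `U`; used for open `U`. -/
def UnivalentOn (f : ℂ → ℂ) (U : Set ℂ) : Prop :=
  AnalyticOnNhd ℂ f U ∧ Set.InjOn f U

/-- `L` is a continuous branch of `log h` on the set `S`; in particular `h` has no zero on `S`. -/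
def IsLogBranchOn (L h : ℂ → ℂ) (S : Set ℂ) : Prop :=
  ContinuousOn L S ∧ ∀ z ∈ S, Complex.exp (L z) = h z

/-- At the boundary point `ζ`, `Q` has a finite limit `w` from inside the disk, and for some
`β > 1` a branch of `(Q - w) ^ β` extends to a univalent function `g` near `ζ`. -/
def HasFiniteCorner (Q : ℂ → ℂ) (ζ : ℂ) : Prop :=
  ∃ w : ℂ, Filter.Tendsto Q (nhdsWithin ζ unitDisk) (nhds w) ∧
    ∃ β : ℝ, 1 < β ∧ ∃ (U : Set ℂ) (g L : ℂ → ℂ), IsOpen U ∧ ζ ∈ U ∧ UnivalentOn g U ∧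
      IsLogBranchOn L (fun z => Q z - w) (U ∩ unitDisk) ∧
      ∀ z ∈ U ∩ unitDisk, g z = Complex.exp ((β : ℂ) * L z)

/-- At the boundary point `ζ`, `Q` tends to `∞` from inside the disk, and for some `β ≥ 1`
a branch of `Q ^ (-β)` extends to a univalent function `g` near `ζ`. If `β = 1`, then `g` is
the extension of `1 / Q`, and `ζ * g' ζ` is required not to lie in the segment `[0, 1]`. -/
def HasInfiniteCorner (Q : ℂ → ℂ) (ζ : ℂ) : Prop :=
  Filter.Tendsto Q (nhdsWithin ζ unitDisk) (Bornology.cobounded ℂ) ∧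
    ∃ β : ℝ, 1 ≤ β ∧ ∃ (U : Set ℂ) (g L : ℂ → ℂ), IsOpen U ∧ ζ ∈ U ∧ UnivalentOn g U ∧
      IsLogBranchOn L Q (U ∩ unitDisk) ∧
      (∀ z ∈ U ∩ unitDisk, g z = Complex.exp (-(β : ℂ) * L z)) ∧
      (β = 1 → ∀ t : ℝ, 0 ≤ t → t ≤ 1 → ζ * deriv g ζ ≠ (t : ℂ))

/-- `Q` belongs to the admissible class, with `E` as its finite set of exceptional points on the
unit circle. -/
structure IsAdmissible (Q : ℂ → ℂ) (E : Finset ℂ) : Prop where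
  exceptional_mem : ∀ ζ ∈ E, ‖ζ‖ = 1
  univalent : ∃ U : Set ℂ, IsOpen U ∧ Metric.closedBall 0 1 \ (E : Set ℂ) ⊆ U ∧ UnivalentOn Q U
  map_zero : Q 0 = 0
  corner : ∀ ζ ∈ E, HasFiniteCorner Q ζ ∨ HasInfiniteCorner Q ζ

/-- Subordination `g ≺ h` on the unit disk. -/
def Subordinate (g h : ℂ → ℂ) : Prop :=
  ∃ ω : ℂ → ℂ, AnalyticOnNhd ℂ ω unitDisk ∧ (∀ z ∈ unitDisk, ‖ω z‖ ≤ ‖z‖) ∧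
    ∀ z ∈ unitDisk, g z = h (ω z)

/-- The class of analytic functions `f` on the disk with `f 0 = 0` and `f' 0 = 1`. -/
def classA1 : Set (ℂ → ℂ) :=
  {f | AnalyticOnNhd ℂ f unitDisk ∧ f 0 = 0 ∧ deriv f 0 = 1}

/-- The class `S*(φ)` of those `f` in `classA1` with `z f' / f ≺ φ`. The quotient has to be
finite, that is, `f` has no zero other than the origin, where the quotient takes its limit `1`. -/
def starClass (φ : ℂ → ℂ) : Set (ℂ → ℂ) :=
  {f | f ∈ classA1 ∧ (∀ z ∈ unitDisk, z ≠ 0 → f z ≠ 0) ∧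
    Subordinate (Function.update (fun z => z * deriv f z / f z) 0 1) φ}

end ShiftedGauss

namespace ShiftedGauss

open Filter Topology Metric

/-! Let F be the hypergeometric function and q = zF'/F, so that zf'/f = 1 + q. It suffices that F
has no zero and that q takes its values in Q(𝔻): then ω = Q⁻¹ ∘ q is the required map, and |ω(z)| ≤
|z| is the Schwarz lemma. The hypergeometric equation becomes the Riccati equation zq' + q(q+c-1) =
z(zq' + (q+a)(q+b)).

Suppose this fails, let z₀ be a bad point of least modulus r, and let ζ be a cluster point of ω
along the radius to z₀. If |ζ| < 1, then q(z₀) = Q(ζ) and z₀ is not bad. So |ζ| = 1, and three cases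
remain.

If ζ is not exceptional, Jack's lemma (`exists_one_le_deriv_comp_eq`) gives z₀q'(z₀) = mY with Y =
ζQ'(ζ), m ≥ 1. The Riccati equation reads mY + A = z₀(mY + B) at z₀, while the hypotheses force |mY
+ B| ≤ |mY + A|. Since |z₀| < 1, both sides vanish, so A = B, against strict positivity
(`false_of_boundary_inequality`).

If Q has a finite corner at ζ, then q is analytic at z₀, and (Q - w)^β makes ω approach ζ at rate
(1-t)^β along the radius. By the Schwarz bound |ω - ζ| ≥ 1 - t, so β > 1 is impossible
(`false_of_norm_comp_le_rpow`).

If Q is infinite at ζ, then F has a zero of some order k at z₀, and 1/q is analytic there. The rate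
argument excludes β > 1. For β = 1, Jack's lemma applied to 1/q gives ζP'(ζ) = 1/(km) ∈ (0,1], which
is excluded. -/

/-! ### Power series on the unit disk and the Euler operator -/

theorem hasFPowerSeriesOnBall_of_hasSum {u : ℕ → ℂ} {F : ℂ → ℂ}
    (hF : ∀ z ∈ unitDisk, HasSum (fun n => u n * z ^ n) (F z)) :
    HasFPowerSeriesOnBall F (FormalMultilinearSeries.ofScalars ℂ u) 0 1 where
  r_le := by
    refine ENNReal.le_of_forall_nnreal_lt fun r hr => ?_
    have hr1 : (r : ℝ) < 1 := by exact_mod_cast hr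
    have h := (hF (r : ℂ) (by simpa using hr1)).summable.tendsto_atTop_zero.norm
    refine FormalMultilinearSeries.le_radius_of_tendsto (l := 0) _ ?_
    simpa using h
  r_pos := one_pos
  hasSum := by
    intro z hz
    have hz' : z ∈ unitDisk := by
      have : z ∈ Metric.eball (0 : ℂ) (ENNReal.ofReal 1) := by simpa using hz
      rwa [Metric.eball_ofReal] at this
    simpa [FormalMultilinearSeries.ofScalars_apply_eq, mul_comm] using hF z hz'

theorem analyticOnNhd_of_hasSum {u : ℕ → ℂ} {F : ℂ → ℂ}
    (hF : ∀ z ∈ unitDisk, HasSum (fun n => u n * z ^ n) (F z)) : AnalyticOnNhd ℂ F unitDisk := by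
  have h := (hasFPowerSeriesOnBall_of_hasSum hF).analyticOnNhd
  rwa [← ENNReal.ofReal_one, Metric.eball_ofReal] at h

theorem hasSum_mul_deriv {u : ℕ → ℂ} {F : ℂ → ℂ}
    (hF : ∀ z ∈ unitDisk, HasSum (fun n => u n * z ^ n) (F z)) :
    ∀ z ∈ unitDisk, HasSum (fun n : ℕ => (n * u n) * z ^ n) (z * deriv F z) := by
  intro z hz
  have h := (hasFPowerSeriesOnBall_of_hasSum hF).fderiv
  have hz' : z ∈ Metric.eball (0 : ℂ) 1 := by
    rwa [← ENNReal.ofReal_one, Metric.eball_ofReal]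
  have h1 := (h.hasSum hz').mapL (ContinuousLinearMap.apply ℂ ℂ (1 : ℂ))
  have h2 := h1.mul_left z
  rw [← hasSum_nat_add_iff' 1]
  have hp : ∀ n : ℕ, (FormalMultilinearSeries.ofScalars ℂ u).coeff n = u n := by
    intro n; simp [FormalMultilinearSeries.coeff_ofScalars]
  have key : (fun n : ℕ => (((n + 1 : ℕ) : ℂ) * u (n + 1)) * z ^ (n + 1)) = fun n => z *
      ContinuousLinearMap.apply ℂ ℂ (1 : ℂ)
        ((FormalMultilinearSeries.ofScalars ℂ u).derivSeries n fun _ => z) := by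
    funext n
    have h3 := FormalMultilinearSeries.derivSeries_coeff_one
      (FormalMultilinearSeries.ofScalars ℂ u) n
    rw [hp] at h3
    have h4 : ((FormalMultilinearSeries.ofScalars ℂ u).derivSeries n fun _ => z) =
        z ^ n • (FormalMultilinearSeries.ofScalars ℂ u).derivSeries.coeff n := by
      rw [← FormalMultilinearSeries.apply_eq_pow_smul_coeff]
    simp only [ContinuousLinearMap.apply_apply, h4, _root_.smul_apply, h3]
    simp only [smul_eq_mul, nsmul_eq_mul]
    push_cast
    ring
  rw [key]
  simpa using h2

/-! ### The hypergeometric series and its differential equation -/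

section Hypergeometric

variable {a b c : ℂ}

theorem ordinaryHypergeometricCoefficient_succ (hc : ∀ n : ℕ, c ≠ -(n : ℂ)) (n : ℕ) :
    ((n : ℂ) + 1) * (n + c) * ordinaryHypergeometricCoefficient a b c (n + 1) =
      (n + a) * (n + b) * ordinaryHypergeometricCoefficient a b c n := by
  have h1 : (ascPochhammer ℂ n).eval c ≠ 0 := by
    rw [Ne, ascPochhammer_eval_eq_zero_iff]
    rintro ⟨k, -, hk⟩
    exact hc k (by rw [hk]; ring)
  have h2 : c + n ≠ 0 := fun h => hc n (eq_neg_of_add_eq_zero_left h)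
  have h3 : (n : ℂ) + 1 ≠ 0 := Nat.cast_add_one_ne_zero n
  have h4 : (n.factorial : ℂ) ≠ 0 := Nat.cast_ne_zero.2 n.factorial_ne_zero
  simp only [ordinaryHypergeometricCoefficient, ascPochhammer_succ_eval, Nat.factorial_succ]
  push_cast
  field_simp
  ring

theorem one_le_radius_ordinaryHypergeometricSeries (hc : ∀ n : ℕ, c ≠ -(n : ℂ)) :
    1 ≤ (ordinaryHypergeometricSeries ℂ a b c).radius := by
  by_cases ha : ∃ k : ℕ, a = -(k : ℂ)
  · obtain ⟨k, rfl⟩ := ha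
    simp [ordinaryHypergeometric_radius_top_of_neg_nat₁]
  by_cases hb : ∃ k : ℕ, b = -(k : ℂ)
  · obtain ⟨k, rfl⟩ := hb
    simp [ordinaryHypergeometric_radius_top_of_neg_nat₂]
  rw [ordinaryHypergeometricSeries_radius_eq_one]
  push Not at ha hb
  exact fun n => ⟨fun h => ha n (by rw [h, neg_neg]), fun h => hb n (by rw [h, neg_neg]),
    fun h => hc n (by rw [h, neg_neg])⟩

theorem hasSum_ordinaryHypergeometric (hc : ∀ n : ℕ, c ≠ -(n : ℂ)) :
    ∀ z ∈ unitDisk, HasSum (fun n => ordinaryHypergeometricCoefficient a b c n * z ^ n)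
      (ordinaryHypergeometric a b c z) := by
  intro z hz
  have h := (ordinaryHypergeometricSeries ℂ a b c).hasFPowerSeriesOnBall
    (one_pos.trans_le (one_le_radius_ordinaryHypergeometricSeries hc))
  have hz' : z ∈ Metric.eball (0 : ℂ) (ordinaryHypergeometricSeries ℂ a b c).radius := by
    refine Metric.eball_subset_eball (one_le_radius_ordinaryHypergeometricSeries hc) ?_
    rwa [← ENNReal.ofReal_one, Metric.eball_ofReal]
  have h2 := h.hasSum hz'
  simp only [ordinaryHypergeometricSeries_apply_eq, zero_add, smul_eq_mul] at h2
  exact h2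

theorem analyticOnNhd_ordinaryHypergeometric (hc : ∀ n : ℕ, c ≠ -(n : ℂ)) :
    AnalyticOnNhd ℂ (ordinaryHypergeometric a b c : ℂ → ℂ) unitDisk :=
  analyticOnNhd_of_hasSum (hasSum_ordinaryHypergeometric hc)

/-- The hypergeometric differential equation, in terms of the Euler operator `z d/dz`. -/
theorem ordinaryHypergeometric_ode (hc : ∀ n : ℕ, c ≠ -(n : ℂ)) {z : ℂ} (hz : z ∈ unitDisk)
    {F T : ℂ → ℂ} (hF : F = ordinaryHypergeometric a b c) (hT : T = fun w => w * deriv F w) :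
    z * deriv T z + (c - 1) * T z = z * (z * deriv T z + (a + b) * T z + a * b * F z) := by
  have h0 := hasSum_ordinaryHypergeometric (a := a) (b := b) hc
  rw [← hF] at h0
  have h1 := hasSum_mul_deriv h0
  have h1' : ∀ z ∈ unitDisk, HasSum (fun n : ℕ =>
      (n * ordinaryHypergeometricCoefficient a b c n) * z ^ n) (T z) := by simpa [hT] using h1
  have h2 := hasSum_mul_deriv h1'
  have hl := (h2 z hz).add ((h1' z hz).mul_left (c - 1))
  have hr := (((h2 z hz).add ((h1' z hz).mul_left (a + b))).add
    ((h0 z hz).mul_left (a * b))).mul_left z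
  -- The constant term on the left is zero and the right side carries a factor z, so coefficients of
  -- z ^ (n + 1) are compared.
  rw [← hasSum_nat_add_iff' 1] at hl
  have key : (fun n : ℕ => ((n + 1 : ℕ) : ℂ) * (((n + 1 : ℕ) : ℂ) *
      ordinaryHypergeometricCoefficient a b c (n + 1)) * z ^ (n + 1) + (c - 1) *
      (((n + 1 : ℕ) : ℂ) * ordinaryHypergeometricCoefficient a b c (n + 1) * z ^ (n + 1))) =
      fun n : ℕ => z * (n * (n * ordinaryHypergeometricCoefficient a b c n) * z ^ n + (a + b) *
      (n * ordinaryHypergeometricCoefficient a b c n * z ^ n) + a * b *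
      (ordinaryHypergeometricCoefficient a b c n * z ^ n)) := by
    funext n
    have h := ordinaryHypergeometricCoefficient_succ (a := a) (b := b) hc n
    push_cast
    linear_combination z ^ (n + 1) * h
  rw [key] at hl
  simpa using hl.unique hr

end Hypergeometric

/-! ### Local univalence and boundary lemmas of Jack type -/

/-- An analytic function that is injective near a point has nonzero derivative there. -/
theorem deriv_ne_zero_of_injOn {g : ℂ → ℂ} {ζ : ℂ} {V : Set ℂ} (hg : AnalyticAt ℂ g ζ)
    (hV : V ∈ 𝓝 ζ) (hinj : Set.InjOn g V) : deriv g ζ ≠ 0 := by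
  intro hd
  have hf : AnalyticAt ℂ (fun z => g z - g ζ) ζ := hg.sub analyticAt_const
  have htop : analyticOrderAt (fun z => g z - g ζ) ζ ≠ ⊤ := by
    intro h
    rw [analyticOrderAt_eq_top] at h
    have h2 : ∀ᶠ z in 𝓝 ζ, z = ζ := by
      filter_upwards [h, hV] with z hz hzV
      exact hinj hzV (mem_of_mem_nhds hV) (sub_eq_zero.1 hz)
    have h3 : ∀ᶠ z in 𝓝[≠] ζ, False := by
      filter_upwards [h2.filter_mono nhdsWithin_le_nhds, self_mem_nhdsWithin] with z hz hz'
      exact hz' hz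
    exact h3.exists.elim fun _ h => h
  obtain ⟨h, hh, hh0, hfh⟩ := (hf.analyticOrderAt_ne_top).1 htop
  set n := analyticOrderNatAt (fun z => g z - g ζ) ζ with hn
  have hn0 : n ≠ 0 := by
    intro h0
    have := hfh.self_of_nhds
    simp [h0] at this
    exact hh0 this.symm
  have hn1 : n ≠ 1 := by
    intro h1
    rw [h1] at hfh
    have hd1 : HasDerivAt (fun z => (z - ζ) ^ 1 • h z) (h ζ) ζ := by
      have := ((hasDerivAt_id ζ).sub_const ζ).mul hh.differentiableAt.hasDerivAt
      simpa [Pi.mul_def] using this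
    have hd2 : HasDerivAt (fun z => g z - g ζ) (deriv g ζ) ζ :=
      hg.differentiableAt.hasDerivAt.sub_const _
    have := (hd1.congr_of_eventuallyEq hfh).unique hd2
    exact hh0 (this.trans hd)
  have hnC : (n : ℂ) ≠ 0 := Nat.cast_ne_zero.2 hn0
  -- An analytic n-th root of h: one root κ of h ζ is fixed, and the logarithm is taken only of h z
  -- / h ζ, which is near 1 and so off the branch cut. Then g - g ζ = φ ^ n with φ a local
  -- homeomorphism.
  set κ : ℂ := h ζ ^ ((n : ℂ)⁻¹) with hκ
  have hκn : κ ^ n = h ζ := Complex.cpow_nat_inv_pow _ hn0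
  have hκ0 : κ ≠ 0 := fun h0 => hh0 (by rw [← hκn, h0, zero_pow hn0])
  set k : ℂ → ℂ := fun z => κ * Complex.exp (Complex.log (h z / h ζ) / n) with hk
  have hka : AnalyticAt ℂ k ζ := by
    have h1 : AnalyticAt ℂ (fun z => h z / h ζ) ζ := hh.div_const
    have h2 : AnalyticAt ℂ (fun z => Complex.log (h z / h ζ)) ζ := by
      apply h1.clog
      simp [div_self hh0]
    exact analyticAt_const.mul (h2.div_const).cexp
  have hkn : ∀ᶠ z in 𝓝 ζ, k z ^ n = h z := by
    filter_upwards [hh.continuousAt.eventually_ne hh0] with z hz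
    simp only [hk, mul_pow, hκn]
    rw [← Complex.exp_nat_mul, mul_div_cancel₀ _ hnC, Complex.exp_log (div_ne_zero hz hh0),
      mul_div_cancel₀ _ hh0]
  set φ : ℂ → ℂ := fun z => (z - ζ) * k z with hφ
  have hφs : HasStrictDerivAt φ κ ζ := by
    have h1 : HasStrictDerivAt (fun z => z - ζ) 1 ζ := (hasStrictDerivAt_id ζ).sub_const ζ
    have h2 := h1.fun_mul hka.hasStrictDerivAt
    have h3 : 1 * k ζ + (ζ - ζ) * deriv k ζ = κ := by simp [hk, div_self hh0]
    rwa [h3] at h2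
  have hmap : map φ (𝓝 ζ) = 𝓝 0 := by
    rw [hφs.map_nhds_eq hκ0]; simp [hφ]
  have hW : {z | z ∈ V ∧ φ z ^ n = g z - g ζ} ∈ 𝓝 ζ := by
    filter_upwards [hV, hkn, hfh] with z h1 h2 h3
    refine ⟨h1, ?_⟩
    simp only [hφ, mul_pow, h2]
    simpa using h3.symm
  have himg : φ '' {z | z ∈ V ∧ φ z ^ n = g z - g ζ} ∈ 𝓝 (0 : ℂ) := by
    rw [← hmap]; exact image_mem_map hW
  -- Points w and ε w near 0 have φ-preimages with the same value of g; for n ≥ 2 these are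
  -- distinct, against injectivity.
  set ε : ℂ := Complex.exp (2 * Real.pi * Complex.I / n) with hε
  have hprim : IsPrimitiveRoot ε n := Complex.isPrimitiveRoot_exp n hn0
  have hmul : Tendsto (fun w : ℂ => ε * w) (𝓝 0) (𝓝 0) := by
    have : Continuous fun w : ℂ => ε * w := by fun_prop
    simpa using this.tendsto 0
  have hev : ∀ᶠ w in 𝓝[≠] (0 : ℂ), w ≠ 0 ∧
      w ∈ φ '' {z | z ∈ V ∧ φ z ^ n = g z - g ζ} ∧
      ε * w ∈ φ '' {z | z ∈ V ∧ φ z ^ n = g z - g ζ} := by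
    filter_upwards [self_mem_nhdsWithin, mem_nhdsWithin_of_mem_nhds himg,
      mem_nhdsWithin_of_mem_nhds (hmul himg)] with w h1 h2 h3
    exact ⟨h1, h2, h3⟩
  obtain ⟨w, hw0, ⟨z₁, ⟨h1V, h1⟩, rfl⟩, ⟨z₂, ⟨h2V, h2⟩, hz2⟩⟩ := hev.exists
  have hgg : g z₂ = g z₁ := by
    have : φ z₂ ^ n = φ z₁ ^ n := by rw [hz2, mul_pow, hprim.pow_eq_one, one_mul]
    linear_combination h1 - h2 + this
  have hz12 := hinj h2V h1V hgg
  rw [hz12] at hz2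
  have : ε = 1 := by
    have h3 : (ε - 1) * φ z₁ = 0 := by linear_combination -hz2
    exact sub_eq_zero.1 ((mul_eq_zero.1 h3).resolve_right hw0)
  exact hprim.ne_one (by omega) this

theorem nonneg_of_hasDerivAt_of_eventually_nonneg {k : ℝ → ℝ} {k' : ℝ} (hk : HasDerivAt k k' 0)
    (h0 : k 0 = 0) (hpos : ∀ᶠ t in 𝓝[>] (0 : ℝ), 0 ≤ k t) : 0 ≤ k' := by
  have h := hk.tendsto_slope.mono_left
    (nhdsWithin_mono 0 fun t (ht : t ∈ Set.Ioi 0) => (Set.mem_Ioi.1 ht).ne')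
  refine ge_of_tendsto h ?_
  filter_upwards [hpos, self_mem_nhdsWithin] with t h1 (h2 : 0 < t)
  rw [slope_def_field, h0]
  simp only [sub_zero]
  positivity

/-- If `ω` is bounded by `‖z‖ / r` in the disk of radius `r` near a boundary point `z₀` and has
modulus one at `z₀`, then `z₀ ω'(z₀) / ω(z₀)` is real and at least one. -/
theorem exists_one_le_mul_deriv_eq {ω : ℂ → ℂ} {ω' z₀ : ℂ} {r : ℝ} (hr : 0 < r) (hz₀ : ‖z₀‖ = r)
    (hω : HasDerivAt ω ω' z₀) (hω1 : ‖ω z₀‖ = 1)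
    (hle : ∀ᶠ z in 𝓝 z₀, ‖z‖ < r → ‖ω z‖ ≤ ‖z‖ / r) :
    ∃ m : ℝ, 1 ≤ m ∧ z₀ * ω' = m * ω z₀ := by
  set M : ℂ := conj (ω z₀) * (z₀ * ω') with hM
  have hconj : conj (ω z₀) * ω z₀ = 1 := by
    rw [mul_comm, Complex.mul_conj, Complex.normSq_eq_norm_sq, hω1]; simp
  -- The bound on ω is differentiated at t = 0 along z₀(1 + tv), which enters the disk because Re v
  -- < 0.
  have key : ∀ v : ℂ, v.re < 0 → (M * v).re ≤ v.re := by
    intro v hv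
    have hline : HasDerivAt (fun t : ℝ => z₀ * (1 + (t : ℂ) * v)) (z₀ * v) 0 := by
      have h1 : HasDerivAt (fun t : ℝ => (t : ℂ)) 1 0 := Complex.ofRealCLM.hasDerivAt
      simpa using ((h1.mul_const v).const_add 1).const_mul z₀
    have hcomp : HasDerivAt (fun t : ℝ => conj (ω z₀) * ω (z₀ * (1 + (t : ℂ) * v))) (M * v) 0 := by
      have h2 : HasDerivAt ω ω' (z₀ * (1 + ((0 : ℝ) : ℂ) * v)) := by simpa using hω
      have h3 := (h2.comp (0 : ℝ) hline).const_mul (conj (ω z₀))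
      have h4 : conj (ω z₀) * (ω' * (z₀ * v)) = M * v := by rw [hM]; ring
      rw [h4] at h3
      exact h3
    have hre : HasDerivAt (fun t : ℝ => (conj (ω z₀) * ω (z₀ * (1 + (t : ℂ) * v))).re)
        (M * v).re 0 := (Complex.reCLM.hasFDerivAt.comp_hasDerivAt (0 : ℝ) hcomp)
    -- A smooth majorant of |1 + tv|, from x ≤ (1 + x²)/2, with the same first-order term.
    have hquad : HasDerivAt (fun t : ℝ => 1 + t * v.re + t ^ 2 * (‖v‖ ^ 2 / 2)) v.re 0 := by
      have h1 : HasDerivAt (fun t : ℝ => t * v.re) v.re 0 := by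
        simpa using (hasDerivAt_id (0 : ℝ)).mul_const v.re
      have h2 : HasDerivAt (fun t : ℝ => t ^ 2 * (‖v‖ ^ 2 / 2)) 0 0 := by
        simpa using (hasDerivAt_pow 2 (0 : ℝ)).mul_const (‖v‖ ^ 2 / 2)
      simpa using (h1.const_add 1).fun_add h2
    have hk := hquad.sub hre
    have hnn := nonneg_of_hasDerivAt_of_eventually_nonneg hk ?_ ?_
    rotate_left
    · simp only [Pi.sub_apply, Complex.ofReal_zero, zero_mul, add_zero, mul_one, hconj]
      simp
    rotate_left
    · linarith
    have hcont : Tendsto (fun t : ℝ => z₀ * (1 + (t : ℂ) * v)) (𝓝[>] 0) (𝓝 z₀) := by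
      have := hline.continuousAt.tendsto
      simp only [Complex.ofReal_zero, zero_mul, add_zero, mul_one] at this
      exact this.mono_left nhdsWithin_le_nhds
    have hsmall : ∀ᶠ t : ℝ in 𝓝[>] 0, t * ‖v‖ ^ 2 < -2 * v.re := by
      have h1 : Continuous fun t : ℝ => t * ‖v‖ ^ 2 := by fun_prop
      have h2 : ∀ᶠ t : ℝ in 𝓝 0, t * ‖v‖ ^ 2 < -2 * v.re :=
        h1.continuousAt.eventually_lt continuousAt_const (by simp; linarith)
      exact h2.filter_mono nhdsWithin_le_nhds
    filter_upwards [hcont.eventually hle, hsmall, self_mem_nhdsWithin] with t h1 h2 (ht : 0 < t)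
    have hnorm : ‖(1 : ℂ) + t * v‖ ^ 2 = 1 + 2 * (t * v.re) + t ^ 2 * ‖v‖ ^ 2 := by
      rw [← Complex.normSq_eq_norm_sq, ← Complex.normSq_eq_norm_sq, Complex.normSq_apply,
        Complex.normSq_apply]
      simp
      ring
    have hlt : ‖(1 : ℂ) + t * v‖ < 1 := by
      have : ‖(1 : ℂ) + t * v‖ ^ 2 < 1 := by rw [hnorm]; nlinarith
      nlinarith [norm_nonneg ((1 : ℂ) + t * v)]
    have h3 := h1 (by rw [norm_mul, hz₀]; nlinarith)
    rw [norm_mul, hz₀, mul_div_cancel_left₀ _ hr.ne'] at h3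
    have h4 : (conj (ω z₀) * ω (z₀ * (1 + (t : ℂ) * v))).re ≤ ‖(1 : ℂ) + t * v‖ := by
      refine (Complex.re_le_norm _).trans ?_
      rw [norm_mul, RCLike.norm_conj, hω1, one_mul]
      exact h3
    have h5 : ‖(1 : ℂ) + t * v‖ ≤ 1 + t * v.re + t ^ 2 * (‖v‖ ^ 2 / 2) := by
      nlinarith [sq_nonneg (‖(1 : ℂ) + t * v‖ - 1)]
    simp only [Pi.sub_apply]
    linarith
  -- The direction v = -1 gives Re M ≥ 1; the directions -ε ± i, with ε → 0, give Im M = 0.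
  have h1 := key (-1) (by simp)
  have him : M.im = 0 := by
    by_contra hne
    have hb : ∀ ε : ℝ, 0 < ε → |M.im| ≤ ε * M.re := by
      intro ε hε
      have h2 := key (-ε + Complex.I) (by simpa using hε)
      have h3 := key (-ε - Complex.I) (by simpa using hε)
      simp at h2 h3
      rw [abs_le]; constructor <;> nlinarith
    simp at h1
    have hpos : 0 < |M.im| := abs_pos.2 hne
    have := hb (|M.im| / (2 * M.re)) (by positivity)
    have h6 : |M.im| / (2 * M.re) * M.re = |M.im| / 2 := by field_simp
    linarith
  refine ⟨M.re, by simpa using h1, ?_⟩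
  have h7 : ((M.re : ℝ) : ℂ) = M := Complex.ext (by simp) (by simp [him])
  rw [h7, hM]
  linear_combination (-z₀ * ω') * hconj

theorem tendsto_ofReal_mul_nhdsLT_one {l : Filter ℝ} (hl : l ≤ 𝓝[<] 1) (z₀ : ℂ) :
    Tendsto (fun t : ℝ => (t : ℂ) * z₀) l (𝓝 z₀) := by
  have h : Continuous fun t : ℝ => (t : ℂ) * z₀ := by fun_prop
  have h1 := h.tendsto 1
  simp only [Complex.ofReal_one, one_mul] at h1
  exact h1.mono_left (hl.trans nhdsWithin_le_nhds)

theorem eventually_norm_ofReal_mul {l : Filter ℝ} (hl : l ≤ 𝓝[<] 1) {z₀ : ℂ} {r : ℝ}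
    (hz₀ : ‖z₀‖ = r) :
    ∀ᶠ t : ℝ in l, 0 < t ∧ t < 1 ∧ ‖(t : ℂ) * z₀‖ = t * r := by
  have h1 : ∀ᶠ t : ℝ in l, 0 < t :=
    (eventually_gt_nhds one_pos).filter_mono (hl.trans nhdsWithin_le_nhds)
  have h2 : ∀ᶠ t : ℝ in l, t < 1 := hl self_mem_nhdsWithin
  filter_upwards [h1, h2] with t h3 h4
  refine ⟨h3, h4, ?_⟩
  rw [norm_mul, hz₀, Complex.norm_real, Real.norm_of_nonneg h3.le]

/-- A boundary version of the lemma of Jack. If `s = g ∘ ω` where `ω` takes values near `ζ`, and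
`ω` clusters radially at the unimodular `ζ`, then `z₀ s'(z₀) = m ζ g'(ζ)` for some real `m ≥ 1`. -/
theorem exists_one_le_deriv_comp_eq {ω g s : ℂ → ℂ} {z₀ ζ : ℂ} {r : ℝ} (hr : 0 < r)
    (hz₀ : ‖z₀‖ = r) (hω : AnalyticOnNhd ℂ ω (ball 0 r))
    (hle : ∀ z ∈ ball (0 : ℂ) r, ‖ω z‖ ≤ ‖z‖ / r) {l : Filter ℝ} [l.NeBot] (hl : l ≤ 𝓝[<] 1)
    (hlim : Tendsto (fun t : ℝ => ω (t * z₀)) l (𝓝 ζ)) (hζ : ‖ζ‖ = 1)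
    (hg : AnalyticAt ℂ g ζ) (hg' : deriv g ζ ≠ 0) (hs : AnalyticAt ℂ s z₀) {N V : Set ℂ}
    (hN : N ∈ 𝓝 z₀) (hV : V ∈ 𝓝 ζ) (hsg : ∀ z ∈ N ∩ ball 0 r, ω z ∈ V → s z = g (ω z)) :
    ∃ m : ℝ, 1 ≤ m ∧ z₀ * deriv s z₀ = m * (ζ * deriv g ζ) := by
  have hpath := tendsto_ofReal_mul_nhdsLT_one hl z₀
  have hball := eventually_norm_ofReal_mul hl hz₀
  have hmem : ∀ᶠ t : ℝ in l, (t : ℂ) * z₀ ∈ ball (0 : ℂ) r := by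
    filter_upwards [hball] with t ⟨h1, h2, h3⟩
    rw [mem_ball_zero_iff, h3]
    nlinarith
  have hs0 : s z₀ = g ζ := by
    refine tendsto_nhds_unique (hs.continuousAt.tendsto.comp hpath) ?_
    refine (hg.continuousAt.tendsto.comp hlim).congr' ?_
    filter_upwards [hmem, hpath hN, hlim hV] with t h1 h2 h3
    exact (hsg _ ⟨h2, h1⟩ h3).symm
  have hstrict : HasStrictDerivAt g (deriv g ζ) ζ := hg.hasStrictDerivAt
  set G := hstrict.localInverse g (deriv g ζ) ζ hg' with hG
  have hleft : ∀ᶠ u in 𝓝 ζ, G (g u) = u := hstrict.eventually_left_inverse hg'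
  have hright : ∀ᶠ w in 𝓝 (g ζ), g (G w) = w := hstrict.eventually_right_inverse hg'
  have hGa : AnalyticAt ℂ G (g ζ) := hg.analyticAt_localInverse hg'
  have hGζ : G (g ζ) = ζ := hleft.self_of_nhds
  -- The local inverse G of g continues ω analytically across z₀. Agreement on the lens inside the
  -- disk follows from the identity theorem, started at one radial point where ω is already close to
  -- ζ.
  set ω₁ : ℂ → ℂ := fun z => G (s z) with hω₁
  have hω₁a : AnalyticAt ℂ ω₁ z₀ := by
    refine AnalyticAt.fun_comp ?_ hs
    rw [hs0]; exact hGa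
  have hω₁0 : ω₁ z₀ = ζ := by simp only [hω₁, hs0, hGζ]
  obtain ⟨δ, hδ, hδa⟩ := Metric.eventually_nhds_iff_ball.1
    (hω₁a.eventually_analyticAt.and hN)
  have hpre : IsPreconnected (ball z₀ δ ∩ ball (0 : ℂ) r) :=
    ((convex_ball z₀ δ).inter (convex_ball 0 r)).isPreconnected
  obtain ⟨O, hO, hOo, hζO⟩ := _root_.mem_nhds_iff.1 (inter_mem hV hleft)
  obtain ⟨t, ht1, ht2, ht3⟩ := (hmem.and ((hpath.eventually_mem (ball_mem_nhds z₀ hδ)).and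
    (hlim.eventually_mem (hOo.mem_nhds hζO)))).exists
  have heq : Set.EqOn ω₁ ω (ball z₀ δ ∩ ball (0 : ℂ) r) := by
    refine AnalyticOnNhd.eqOn_of_preconnected_of_eventuallyEq (z₀ := (t : ℂ) * z₀)
      (fun z hz => (hδa z hz.1).1) (fun z hz => hω z hz.2) hpre ⟨ht2, ht1⟩ ?_
    have h1 : ∀ᶠ z in 𝓝 ((t : ℂ) * z₀), ω z ∈ O :=
      (hω _ ht1).continuousAt.eventually_mem (hOo.mem_nhds ht3)
    filter_upwards [h1, isOpen_ball.mem_nhds ht1, isOpen_ball.mem_nhds ht2] with z h2 h3 h4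
    simp only [hω₁]
    rw [hsg z ⟨(hδa z h4).2, h3⟩ (hO h2).1]
    exact (hO h2).2
  obtain ⟨m, hm, hmeq⟩ := exists_one_le_mul_deriv_eq hr hz₀
    hω₁a.differentiableAt.hasDerivAt (by rw [hω₁0, hζ]) (by
      filter_upwards [ball_mem_nhds z₀ hδ] with z h1 h2
      have h3 : z ∈ ball (0 : ℂ) r := by simpa using h2
      rw [heq ⟨h1, h3⟩]
      exact hle z h3)
  refine ⟨m, hm, ?_⟩
  have hder : HasDerivAt (fun z => g (ω₁ z)) (deriv g ζ * deriv ω₁ z₀) z₀ := by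
    have h1 : HasDerivAt g (deriv g ζ) (ω₁ z₀) := by
      rw [hω₁0]; exact hg.differentiableAt.hasDerivAt
    exact h1.comp z₀ hω₁a.differentiableAt.hasDerivAt
  have hsder : deriv s z₀ = deriv g ζ * deriv ω₁ z₀ := by
    refine ((hder.congr_of_eventuallyEq ?_).deriv)
    have h1 := hs.continuousAt.tendsto
    rw [hs0] at h1
    filter_upwards [h1.eventually hright] with z hz
    exact hz.symm
  rw [hsder]
  rw [hω₁0] at hmeq
  linear_combination deriv g ζ * hmeq

/-- A self-map of the disk cannot approach a boundary point faster than linearly. -/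
theorem false_of_norm_comp_le_rpow {ω g : ℂ → ℂ} {g' z₀ ζ : ℂ} {r β C : ℝ} (hr : 0 < r)
    (hz₀ : ‖z₀‖ = r) (hle : ∀ z ∈ ball (0 : ℂ) r, ‖ω z‖ ≤ ‖z‖ / r)
    {l : Filter ℝ} [l.NeBot] (hl : l ≤ 𝓝[<] 1)
    (hlim : Tendsto (fun t : ℝ => ω (t * z₀)) l (𝓝 ζ)) (hζ : ‖ζ‖ = 1)
    (hg : HasDerivAt g g' ζ) (hg' : g' ≠ 0) (hβ : 1 < β) (hC : 0 ≤ C)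
    (hbound : ∀ᶠ t : ℝ in l, ‖g (ω (t * z₀))‖ ≤ (C * (1 - t)) ^ β) : False := by
  have hone : Tendsto (fun t : ℝ => 1 - t) l (𝓝 0) := by
    have h : Continuous fun t : ℝ => 1 - t := by fun_prop
    have h1 := h.tendsto 1
    rw [sub_self] at h1
    exact h1.mono_left (hl.trans nhdsWithin_le_nhds)
  have hpow : Tendsto (fun t : ℝ => (1 - t) ^ (β - 1)) l (𝓝 0) := by
    have := hone.rpow_const (p := β - 1) (Or.inr (by linarith))
    rwa [Real.zero_rpow (by linarith)] at this
  have hpowβ : Tendsto (fun t : ℝ => (C * (1 - t)) ^ β) l (𝓝 0) := by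
    have := (hone.const_mul C).rpow_const (p := β) (Or.inr (by linarith))
    rwa [mul_zero, Real.zero_rpow (by linarith)] at this
  have hg0 : g ζ = 0 := by
    refine tendsto_nhds_unique (hg.continuousAt.tendsto.comp hlim) ?_
    exact squeeze_zero_norm' hbound hpowβ
  have hO : (fun u => u - ζ) =O[𝓝 ζ] fun u => g u - g ζ :=
    (HasDerivAtFilter.isTheta_sub hg hg').2.comp_tendsto
      (tendsto_id.prodMk (tendsto_pure.2 (Eventually.of_forall fun _ => rfl)))
  obtain ⟨K, hK, hKb⟩ := hO.exists_pos
  rw [Asymptotics.isBigOWith_iff] at hKb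
  have hball := eventually_norm_ofReal_mul hl hz₀
  have hlt : ∀ᶠ t : ℝ in l, K * C ^ β * (1 - t) ^ (β - 1) < 1 := by
    have := hpow.const_mul (K * C ^ β)
    rw [mul_zero] at this
    exact this.eventually_lt_const one_pos
  obtain ⟨t, ⟨ht0, ht1, htn⟩, h2, h3, h4⟩ :=
    (hball.and ((hlim.eventually hKb).and (hbound.and hlt))).exists
  rw [hg0, sub_zero] at h2
  have h5 := hle ((t : ℂ) * z₀) (by rw [mem_ball_zero_iff, htn]; nlinarith)
  rw [htn, mul_div_cancel_right₀ _ hr.ne'] at h5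
  -- On the radius |ω| ≤ t while |ζ| = 1.
  have h6 : 1 - t ≤ ‖ω (t * z₀) - ζ‖ := by
    have := norm_sub_norm_le ζ (ω (t * z₀))
    rw [norm_sub_rev, hζ] at this
    linarith
  have h7 : (C * (1 - t)) ^ β = C ^ β * (1 - t) ^ (β - 1) * (1 - t) := by
    rw [Real.mul_rpow hC (by linarith), mul_assoc, ← Real.rpow_add_one (by linarith)]
    simp
  have h8 : 1 - t ≤ K * C ^ β * (1 - t) ^ (β - 1) * (1 - t) :=
    calc 1 - t ≤ K * ‖g (ω (t * z₀))‖ := h6.trans h2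
      _ ≤ K * (C ^ β * (1 - t) ^ (β - 1) * (1 - t)) := by
        rw [← h7]; gcongr
      _ = _ := by ring
  nlinarith

/-! ### Zeros of F, inverses of univalent maps and the Riccati equation -/

/-- Near a zero `z₀ ≠ 0` of `F`, the reciprocal of `z F' / F` is analytic, vanishes at `z₀`, and
its Euler derivative there is the reciprocal of the multiplicity. -/
theorem exists_analyticAt_inv_logDeriv {F : ℂ → ℂ} {z₀ : ℂ} (hF : AnalyticAt ℂ F z₀)
    (hF0 : F z₀ = 0) (hne : ¬ ∀ᶠ z in 𝓝 z₀, F z = 0) (hz₀ : z₀ ≠ 0) :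
    ∃ (s : ℂ → ℂ) (k : ℕ), AnalyticAt ℂ s z₀ ∧ s z₀ = 0 ∧ 1 ≤ k ∧ z₀ * deriv s z₀ = 1 / k ∧
      ∀ᶠ z in 𝓝[≠] z₀, z * deriv F z / F z * s z = 1 := by
  obtain ⟨h, hh, hh0, hfh⟩ := (hF.analyticOrderAt_ne_top).1 (by rwa [Ne, analyticOrderAt_eq_top])
  set n := analyticOrderNatAt F z₀ with hn
  have hn0 : n ≠ 0 := by
    intro h0
    have := hfh.self_of_nhds
    simp [h0, hF0] at this
    exact hh0 this.symm
  have hnC : (n : ℂ) ≠ 0 := Nat.cast_ne_zero.2 hn0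
  -- With F = (z - z₀)ⁿ h one has zF' = (z - z₀)ⁿ⁻¹ D, hence the reciprocal (z - z₀) h / D.
  set D : ℂ → ℂ := fun z => z * (n * h z + (z - z₀) * deriv h z) with hD
  have hDa : AnalyticAt ℂ D z₀ := by
    have h1 := hh.deriv
    simp only [hD]
    fun_prop
  have hD0 : D z₀ ≠ 0 := by
    simp only [hD, sub_self, zero_mul, add_zero]
    exact mul_ne_zero hz₀ (mul_ne_zero hnC hh0)
  have hder : ∀ᶠ z in 𝓝 z₀, z * deriv F z = (z - z₀) ^ (n - 1) * D z := by
    filter_upwards [hfh.eventually_nhds, hh.eventually_analyticAt] with z h1 h2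
    have h3 : HasDerivAt (fun z => (z - z₀) ^ n * h z)
        (n * (z - z₀) ^ (n - 1) * h z + (z - z₀) ^ n * deriv h z) z := by
      have h4 := (((hasDerivAt_id z).sub_const z₀).fun_pow n).fun_mul
        h2.differentiableAt.hasDerivAt
      simpa using h4
    have h5 : deriv F z = n * (z - z₀) ^ (n - 1) * h z + (z - z₀) ^ n * deriv h z :=
      (h3.congr_of_eventuallyEq h1).deriv
    obtain ⟨j, hj⟩ := Nat.exists_eq_succ_of_ne_zero hn0
    rw [h5, hj]
    simp only [hD, hj, Nat.succ_eq_add_one, Nat.add_sub_cancel]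
    ring
  have hHD : AnalyticAt ℂ (fun z => h z / D z) z₀ := hh.div hDa hD0
  refine ⟨fun z => (z - z₀) * (h z / D z), n, ?_, by simp, Nat.one_le_iff_ne_zero.2 hn0, ?_, ?_⟩
  · fun_prop
  · have h1 := ((hasDerivAt_id z₀).sub_const z₀).fun_mul hHD.differentiableAt.hasDerivAt
    have h2 := h1.deriv
    simp only [id] at h2
    rw [h2]
    simp only [hD, sub_self, zero_mul, add_zero, one_mul]
    field_simp
  · filter_upwards [hfh.filter_mono nhdsWithin_le_nhds, hder.filter_mono nhdsWithin_le_nhds,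
      (hh.continuousAt.eventually_ne hh0).filter_mono nhdsWithin_le_nhds,
      (hDa.continuousAt.eventually_ne hD0).filter_mono nhdsWithin_le_nhds,
      self_mem_nhdsWithin] with z h1 h2 h3 h4 h5
    have h6 : z - z₀ ≠ 0 := sub_ne_zero.2 h5
    rw [h1, h2]
    obtain ⟨j, hj⟩ := Nat.exists_eq_succ_of_ne_zero hn0
    simp only [hj, smul_eq_mul, Nat.succ_eq_add_one, Nat.add_sub_cancel]
    field_simp
    ring

theorem analyticAt_invFunOn {Q : ℂ → ℂ} {D : Set ℂ} (hD : IsOpen D) (hQ : UnivalentOn Q D)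
    {w : ℂ} (hw : w ∈ Q '' D) : AnalyticAt ℂ (Function.invFunOn Q D) w := by
  obtain ⟨u, hu, rfl⟩ := hw
  have hd := deriv_ne_zero_of_injOn (hQ.1 u hu) (hD.mem_nhds hu) hQ.2
  have hstrict : HasStrictDerivAt Q (deriv Q u) u := (hQ.1 u hu).hasStrictDerivAt
  refine ((hQ.1 u hu).analyticAt_localInverse hd).congr ?_
  have h1 := hstrict.eventually_right_inverse hd
  have h0 := (hstrict.eventually_left_inverse hd).self_of_nhds
  have h2 := (hstrict.to_localInverse hd).hasDerivAt.continuousAt.tendsto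
  rw [h0] at h2
  filter_upwards [h1, h2 (hD.mem_nhds hu)] with w hw1 hw2
  have h3 : Q (Function.invFunOn Q D w) = w := Function.invFunOn_eq ⟨_, hw2, hw1⟩
  have h4 : Function.invFunOn Q D w ∈ D := Function.invFunOn_mem ⟨_, hw2, hw1⟩
  exact hQ.2 hw2 h4 (hw1.trans h3.symm)

theorem isOpen_image_of_univalentOn {Q : ℂ → ℂ} {D : Set ℂ} (hD : IsOpen D)
    (hQ : UnivalentOn Q D) : IsOpen (Q '' D) := by
  rw [isOpen_iff_mem_nhds]
  rintro _ ⟨u, hu, rfl⟩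
  have hd := deriv_ne_zero_of_injOn (hQ.1 u hu) (hD.mem_nhds hu) hQ.2
  rw [← (hQ.1 u hu).hasStrictDerivAt.map_nhds_eq hd]
  exact image_mem_map (hD.mem_nhds hu)

/-- The function `z F'(z) / F(z)`. -/
noncomputable def eulerLogDeriv (F : ℂ → ℂ) (z : ℂ) : ℂ := z * deriv F z / F z

theorem eulerLogDeriv_zero (F : ℂ → ℂ) : eulerLogDeriv F 0 = 0 := by simp [eulerLogDeriv]

theorem analyticAt_eulerLogDeriv {F : ℂ → ℂ} {z : ℂ} (hF : AnalyticAt ℂ F z) (h : F z ≠ 0) :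
    AnalyticAt ℂ (eulerLogDeriv F) z :=
  (analyticAt_id.mul hF.deriv).div hF h

/-- The Riccati equation satisfied by `z F' / F`. -/
theorem eulerLogDeriv_ordinaryHypergeometric_riccati {a b c : ℂ} (hc : ∀ n : ℕ, c ≠ -(n : ℂ))
    {F : ℂ → ℂ} (hF : F = ordinaryHypergeometric a b c) {z : ℂ} (hz : z ∈ unitDisk)
    (h : F z ≠ 0) :
    z * deriv (eulerLogDeriv F) z + eulerLogDeriv F z * (eulerLogDeriv F z + c - 1) =
      z * (z * deriv (eulerLogDeriv F) z + (eulerLogDeriv F z + a) * (eulerLogDeriv F z + b)) := by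
  have hFa : AnalyticAt ℂ F z := by
    rw [hF]; exact analyticOnNhd_ordinaryHypergeometric hc z hz
  set T : ℂ → ℂ := fun w => w * deriv F w with hT
  have hTa : AnalyticAt ℂ T z := analyticAt_id.mul hFa.deriv
  have hode := ordinaryHypergeometric_ode hc hz hF hT
  have hder : deriv (eulerLogDeriv F) z = (deriv T z * F z - T z * deriv F z) / F z ^ 2 :=
    (hTa.differentiableAt.hasDerivAt.div hFa.differentiableAt.hasDerivAt h).deriv
  have hq : eulerLogDeriv F z = T z / F z := rfl
  have hTz : T z = z * deriv F z := rfl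
  rw [hder, hq]
  field_simp
  linear_combination (F z) * hode + (1 - z) * T z * hTz

/-- Expanding the squares, |mY+B|² - |mY+A|² = |B|² - |A|² - mX, where X is the positive right-hand
side; this is at most (1 - m)X ≤ 0. -/
theorem false_of_boundary_inequality {A B Y z₀ : ℂ} {m : ℝ} (hm : 1 ≤ m) (hz₀ : ‖z₀‖ < 1)
    (h : m * Y + A = z₀ * (m * Y + B)) (h₁ : 0 < -2 * ((B - A) * conj Y).re)
    (h₂ : ‖B‖ ^ 2 - ‖A‖ ^ 2 ≤ -2 * ((B - A) * conj Y).re) : False := by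
  have key : ‖m * Y + B‖ ^ 2 - ‖m * Y + A‖ ^ 2 =
      ‖B‖ ^ 2 - ‖A‖ ^ 2 + m * (2 * ((B - A) * conj Y).re) := by
    simp only [← Complex.normSq_eq_norm_sq, Complex.normSq_apply]
    simp
    ring
  have hle : ‖m * Y + B‖ ^ 2 ≤ ‖m * Y + A‖ ^ 2 := by nlinarith
  rw [h, norm_mul, mul_pow] at hle
  have hlt : ‖z₀‖ ^ 2 < 1 := by nlinarith [norm_nonneg z₀]
  have h3 : ‖m * Y + B‖ ^ 2 = 0 :=
    le_antisymm (by nlinarith [sq_nonneg ‖m * Y + B‖]) (sq_nonneg _)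
  have h4 : m * Y + B = 0 := by simpa using h3
  have h5 : m * Y + A = 0 := by rw [h, h4, mul_zero]
  have h6 : B - A = 0 := by linear_combination h4 - h5
  simp [h6] at h₁

/-! ### The lift ω = Q⁻¹ ∘ (zF'/F) and radial limits -/

/-- The lift of `z F' / F` through a univalent `Q`. -/
noncomputable def liftThrough (F Q : ℂ → ℂ) (z : ℂ) : ℂ :=
  Function.invFunOn Q unitDisk (eulerLogDeriv F z)

section Lift

variable {F Q : ℂ → ℂ} {r : ℝ}

theorem liftThrough_mem {z : ℂ} (h : eulerLogDeriv F z ∈ Q '' unitDisk) :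
    liftThrough F Q z ∈ unitDisk :=
  Function.invFunOn_mem h

theorem map_liftThrough {z : ℂ} (h : eulerLogDeriv F z ∈ Q '' unitDisk) :
    Q (liftThrough F Q z) = eulerLogDeriv F z :=
  Function.invFunOn_eq h

theorem liftThrough_zero (hQ : UnivalentOn Q unitDisk) (hQ0 : Q 0 = 0) :
    liftThrough F Q 0 = 0 := by
  have h0 : (0 : ℂ) ∈ unitDisk := by simp
  have h : eulerLogDeriv F 0 ∈ Q '' unitDisk := ⟨0, h0, by rw [hQ0, eulerLogDeriv_zero]⟩
  exact hQ.2 (liftThrough_mem h) h0 (by rw [map_liftThrough h, hQ0, eulerLogDeriv_zero])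

variable (hF : AnalyticOnNhd ℂ F unitDisk) (hr1 : r ≤ 1) (hQ : UnivalentOn Q unitDisk)
  (hgood : ∀ z ∈ ball (0 : ℂ) r, F z ≠ 0 ∧ eulerLogDeriv F z ∈ Q '' unitDisk)

include hF hr1 hQ hgood

theorem analyticOnNhd_liftThrough : AnalyticOnNhd ℂ (liftThrough F Q) (ball 0 r) := by
  intro z hz
  exact (analyticAt_invFunOn isOpen_ball hQ (hgood z hz).2).comp
    (analyticAt_eulerLogDeriv (hF z (ball_subset_ball hr1 hz)) (hgood z hz).1)

theorem norm_liftThrough_le (hQ0 : Q 0 = 0) :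
    ∀ z ∈ ball (0 : ℂ) r, ‖liftThrough F Q z‖ ≤ ‖z‖ / r := by
  intro z hz
  have h0 : liftThrough F Q 0 = 0 := liftThrough_zero hQ hQ0
  have h := Complex.dist_le_div_mul_dist_of_mapsTo_ball (R₂ := 1)
    (analyticOnNhd_liftThrough hF hr1 hQ hgood).differentiableOn
    (fun w hw => by rw [h0]; exact ball_subset_closedBall (liftThrough_mem (hgood w hw).2)) hz
  rw [h0, dist_zero_right, dist_zero_right] at h
  rwa [one_div_mul_eq_div] at h

end Lift

theorem norm_cexp_ofReal_mul (β : ℝ) (w : ℂ) :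
    ‖Complex.exp ((β : ℂ) * w)‖ = ‖Complex.exp w‖ ^ β := by
  rw [Complex.norm_exp, Complex.norm_exp, ← Real.exp_mul]
  simp [mul_comm]

theorem exists_norm_sub_le_radial {f : ℂ → ℂ} {z₀ : ℂ} (hf : DifferentiableAt ℂ f z₀)
    {l : Filter ℝ} (hl : l ≤ 𝓝[<] 1) :
    ∃ C : ℝ, 0 ≤ C ∧ ∀ᶠ t : ℝ in l, ‖f (t * z₀) - f z₀‖ ≤ C * (1 - t) := by
  obtain ⟨C, hC, hb⟩ := hf.isBigO_sub.exists_nonneg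
  rw [Asymptotics.isBigOWith_iff] at hb
  refine ⟨C * ‖z₀‖, by positivity, ?_⟩
  filter_upwards [(tendsto_ofReal_mul_nhdsLT_one hl z₀).eventually hb, hl self_mem_nhdsWithin]
    with t h1 (h2 : t < 1)
  have h3 : ‖(t : ℂ) * z₀ - z₀‖ = ‖z₀‖ * (1 - t) := by
    have : (t : ℂ) * z₀ - z₀ = ((t - 1 : ℝ) : ℂ) * z₀ := by push_cast; ring
    rw [this, norm_mul, Complex.norm_real, Real.norm_eq_abs, abs_of_neg (by linarith)]
    ring
  rw [h3] at h1
  linarith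

theorem not_eventually_eq_zero {F : ℂ → ℂ} (hF : AnalyticOnNhd ℂ F unitDisk) (hF0 : F 0 = 1)
    {z₀ : ℂ} (hz₀ : z₀ ∈ unitDisk) : ¬ ∀ᶠ z in 𝓝 z₀, F z = 0 := by
  intro h
  have := hF.eqOn_zero_of_preconnected_of_eventuallyEq_zero
    (convex_ball (0 : ℂ) 1).isPreconnected hz₀ h (show (0 : ℂ) ∈ unitDisk by simp)
  simp [hF0] at this

/-- If `z F' / F` has a finite limit along a radial filter, then `F` does not vanish at the
endpoint, and the limit is the value there. -/
theorem ne_zero_of_tendsto_eulerLogDeriv {F : ℂ → ℂ} (hF : AnalyticOnNhd ℂ F unitDisk)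
    (hF0 : F 0 = 1) {z₀ w : ℂ} (hz₀ : z₀ ∈ unitDisk) (hne : z₀ ≠ 0) {l : Filter ℝ} [l.NeBot]
    (hl : l ≤ 𝓝[<] 1) (hlim : Tendsto (fun t : ℝ => eulerLogDeriv F (t * z₀)) l (𝓝 w)) :
    F z₀ ≠ 0 ∧ eulerLogDeriv F z₀ = w := by
  have hpath := tendsto_ofReal_mul_nhdsLT_one hl z₀
  have h0 : F z₀ ≠ 0 := by
    intro h0
    obtain ⟨s, k, hs, hs0, -, -, hqs⟩ := exists_analyticAt_inv_logDeriv (hF z₀ hz₀) h0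
      (not_eventually_eq_zero hF hF0 hz₀) hne
    have hpath' : Tendsto (fun t : ℝ => (t : ℂ) * z₀) l (𝓝[≠] z₀) := by
      refine tendsto_nhdsWithin_iff.2 ⟨hpath, ?_⟩
      filter_upwards [hl self_mem_nhdsWithin] with t (ht : t < 1) h
      have h2 : (t : ℂ) = 1 := mul_right_cancel₀ hne (h.trans (one_mul z₀).symm)
      exact ht.ne (by exact_mod_cast h2)
    have h1 := hlim.mul (hs.continuousAt.tendsto.comp hpath)
    rw [hs0, mul_zero] at h1
    have h2 : Tendsto (fun _ : ℝ => (1 : ℂ)) l (𝓝 0) :=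
      h1.congr' (hpath'.eventually hqs)
    exact one_ne_zero (tendsto_nhds_unique tendsto_const_nhds h2)
  exact ⟨h0, tendsto_nhds_unique
    ((analyticAt_eulerLogDeriv (hF z₀ hz₀) h0).continuousAt.tendsto.comp hpath) hlim⟩

theorem eq_zero_of_tendsto_eulerLogDeriv_cobounded {F : ℂ → ℂ}
    (hF : AnalyticOnNhd ℂ F unitDisk) {z₀ : ℂ} (hz₀ : z₀ ∈ unitDisk) {l : Filter ℝ} [l.NeBot]
    (hl : l ≤ 𝓝[<] 1)
    (hlim : Tendsto (fun t : ℝ => eulerLogDeriv F (t * z₀)) l (Bornology.cobounded ℂ)) :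
    F z₀ = 0 := by
  by_contra h0
  have h1 := (analyticAt_eulerLogDeriv (hF z₀ hz₀) h0).continuousAt.tendsto.comp
    (tendsto_ofReal_mul_nhdsLT_one hl z₀)
  have h2 := tendsto_norm_cobounded_atTop.comp hlim
  exact not_tendsto_nhds_of_tendsto_atTop h2 _ h1.norm

theorem IsAdmissible.univalentOn_unitDisk {Q : ℂ → ℂ} {E : Finset ℂ} (hQ : IsAdmissible Q E) :
    UnivalentOn Q unitDisk := by
  obtain ⟨U, -, hsub, hU⟩ := hQ.univalent
  have h : unitDisk ⊆ U := fun z hz => hsub ⟨ball_subset_closedBall hz, fun hE => by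
    have h1 := hQ.exceptional_mem z hE
    rw [mem_ball_zero_iff] at hz
    exact hz.ne h1⟩
  exact ⟨hU.1.mono h, hU.2.mono h⟩

theorem IsAdmissible.analyticAt_of_norm_eq_one {Q : ℂ → ℂ} {E : Finset ℂ}
    (hQ : IsAdmissible Q E) {ζ : ℂ} (hζ : ‖ζ‖ = 1) (hE : ζ ∉ E) : AnalyticAt ℂ Q ζ := by
  obtain ⟨U, -, hsub, hU⟩ := hQ.univalent
  exact hU.1 ζ (hsub ⟨by simp [hζ], hE⟩)

/-! ### Exclusion of the exceptional boundary points -/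

section Cases

variable {F Q : ℂ → ℂ} {E : Finset ℂ} {r : ℝ} {z₀ ζ : ℂ} {l : Filter ℝ}
  (hF : AnalyticOnNhd ℂ F unitDisk) (hF0 : F 0 = 1) (hr : 0 < r) (hr1 : r < 1)
  (hz₀ : ‖z₀‖ = r) (hQ : UnivalentOn Q unitDisk) (hQ0 : Q 0 = 0)
  (hgood : ∀ z ∈ ball (0 : ℂ) r, F z ≠ 0 ∧ eulerLogDeriv F z ∈ Q '' unitDisk)
  (hl : l ≤ 𝓝[<] 1) (hlim : Tendsto (fun t : ℝ => liftThrough F Q (t * z₀)) l (𝓝 ζ))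

include hr hz₀ hl in
theorem eventually_ofReal_mul_mem_ball : ∀ᶠ t : ℝ in l, (t : ℂ) * z₀ ∈ ball (0 : ℂ) r := by
  filter_upwards [eventually_norm_ofReal_mul hl hz₀] with t ⟨h1, h2, h3⟩
  rw [mem_ball_zero_iff, h3]
  nlinarith

include hr hz₀ hgood hl hlim in
theorem tendsto_liftThrough_nhdsWithin :
    Tendsto (fun t : ℝ => liftThrough F Q (t * z₀)) l (𝓝[unitDisk] ζ) := by
  refine tendsto_nhdsWithin_iff.2 ⟨hlim, ?_⟩
  filter_upwards [eventually_ofReal_mul_mem_ball hr hz₀ hl] with t ht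
  exact liftThrough_mem (hgood _ ht).2

include hr hz₀ hgood hl hlim in
theorem tendsto_eulerLogDeriv_of_tendsto {f : Filter ℂ} (hf : Tendsto Q (𝓝[unitDisk] ζ) f) :
    Tendsto (fun t : ℝ => eulerLogDeriv F (t * z₀)) l f := by
  refine (hf.comp (tendsto_liftThrough_nhdsWithin hr hz₀ hgood hl hlim)).congr' ?_
  filter_upwards [eventually_ofReal_mul_mem_ball hr hz₀ hl] with t ht
  exact map_liftThrough (hgood _ ht).2

variable [l.NeBot]

include hF hF0 hr hr1 hz₀ hQ hQ0 hgood hl hlim in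
theorem not_hasFiniteCorner (hζ : ‖ζ‖ = 1) : ¬ HasFiniteCorner Q ζ := by
  rintro ⟨w, hw, β, hβ, U, g, L, hUo, hζU, hg, hL, hgL⟩
  have hz₀D : z₀ ∈ unitDisk := by rw [mem_ball_zero_iff, hz₀]; exact hr1
  have hz₀0 : z₀ ≠ 0 := norm_pos_iff.1 (hz₀ ▸ hr)
  obtain ⟨hFz, hqw⟩ := ne_zero_of_tendsto_eulerLogDeriv hF hF0 hz₀D hz₀0 hl
    (tendsto_eulerLogDeriv_of_tendsto hr hz₀ hgood hl hlim hw)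
  obtain ⟨C, hC, hCb⟩ := exists_norm_sub_le_radial
    (analyticAt_eulerLogDeriv (hF z₀ hz₀D) hFz).differentiableAt hl
  refine false_of_norm_comp_le_rpow hr hz₀ (norm_liftThrough_le hF hr1.le hQ hgood hQ0) hl hlim hζ
    (hg.1 ζ hζU).differentiableAt.hasDerivAt
    (deriv_ne_zero_of_injOn (hg.1 ζ hζU) (hUo.mem_nhds hζU) hg.2) hβ hC ?_
  filter_upwards [eventually_ofReal_mul_mem_ball hr hz₀ hl, hlim.eventually_mem (hUo.mem_nhds hζU),
    hCb] with t h1 h2 h3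
  have h4 : liftThrough F Q (t * z₀) ∈ U ∩ unitDisk := ⟨h2, liftThrough_mem (hgood _ h1).2⟩
  rw [hgL _ h4, norm_cexp_ofReal_mul, hL.2 _ h4]
  beta_reduce
  rw [map_liftThrough (hgood _ h1).2, ← hqw]
  exact Real.rpow_le_rpow (norm_nonneg _) h3 (by linarith)

include hF hF0 hr hr1 hz₀ hQ hQ0 hgood hl hlim in
theorem not_hasInfiniteCorner (hζ : ‖ζ‖ = 1) : ¬ HasInfiniteCorner Q ζ := by
  rintro ⟨hinf, β, hβ, U, g, L, hUo, hζU, hg, hL, hgL, hβ1⟩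
  have hz₀D : z₀ ∈ unitDisk := by rw [mem_ball_zero_iff, hz₀]; exact hr1
  have hz₀0 : z₀ ≠ 0 := norm_pos_iff.1 (hz₀ ▸ hr)
  have hFz := eq_zero_of_tendsto_eulerLogDeriv_cobounded hF hz₀D hl
    (tendsto_eulerLogDeriv_of_tendsto hr hz₀ hgood hl hlim hinf)
  obtain ⟨s, k, hs, hs0, hk, hsk, hqs⟩ := exists_analyticAt_inv_logDeriv (hF z₀ hz₀D) hFz
    (not_eventually_eq_zero hF hF0 hz₀D) hz₀0
  rw [eventually_nhdsWithin_iff] at hqs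
  -- Since |z₀| = r, the puncture at z₀ lies outside the open ball.
  have hqs' : ∀ z, (z ∈ ({z₀}ᶜ : Set ℂ) → z * deriv F z / F z * s z = 1) → z ∈ ball (0 : ℂ) r →
      eulerLogDeriv F z * s z = 1 := fun z h1 h2 => h1 fun h => by
    rw [mem_ball_zero_iff, h, hz₀] at h2
    exact lt_irrefl _ h2
  rcases hβ.eq_or_lt with hβe | hβlt
  · subst hβe
    have hd : deriv g ζ ≠ 0 := by
      intro h
      exact hβ1 rfl 0 le_rfl zero_le_one (by simp [h])
    obtain ⟨m, hm, hmeq⟩ := exists_one_le_deriv_comp_eq hr hz₀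
      (analyticOnNhd_liftThrough hF hr1.le hQ hgood) (norm_liftThrough_le hF hr1.le hQ hgood hQ0)
      hl hlim hζ (hg.1 ζ hζU) hd hs hqs (hUo.mem_nhds hζU) (by
        rintro z ⟨h1, h2⟩ h3
        have h4 : liftThrough F Q z ∈ U ∩ unitDisk := ⟨h3, liftThrough_mem (hgood _ h2).2⟩
        have h5 := hqs' z h1 h2
        rw [hgL _ h4]
        simp only [Complex.ofReal_one, neg_mul, one_mul]
        rw [Complex.exp_neg, hL.2 _ h4, map_liftThrough (hgood _ h2).2]
        exact eq_inv_of_mul_eq_one_right h5)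
    have hkm : (1 : ℝ) ≤ k * m := by
      have : (1 : ℝ) ≤ k := by exact_mod_cast hk
      nlinarith
    -- Here 1/k = z₀s'(z₀) = m ζ g'(ζ).
    refine hβ1 rfl (1 / (k * m)) (by positivity) ((div_le_one (by linarith)).2 hkm) ?_
    rw [hsk] at hmeq
    have hmC : (m : ℂ) ≠ 0 := by
      exact_mod_cast (by linarith : m ≠ 0)
    have hkC : (k : ℂ) ≠ 0 := by
      exact_mod_cast (by omega : k ≠ 0)
    push_cast
    field_simp at hmeq ⊢
    linear_combination -hmeq
  · obtain ⟨C, hC, hCb⟩ := exists_norm_sub_le_radial hs.differentiableAt hl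
    refine false_of_norm_comp_le_rpow hr hz₀ (norm_liftThrough_le hF hr1.le hQ hgood hQ0) hl hlim
      hζ (hg.1 ζ hζU).differentiableAt.hasDerivAt
      (deriv_ne_zero_of_injOn (hg.1 ζ hζU) (hUo.mem_nhds hζU) hg.2) hβlt hC ?_
    filter_upwards [eventually_ofReal_mul_mem_ball hr hz₀ hl,
      hlim.eventually_mem (hUo.mem_nhds hζU), hCb,
      (tendsto_ofReal_mul_nhdsLT_one hl z₀).eventually hqs] with t h1 h2 h3 h4
    have h5 : liftThrough F Q (t * z₀) ∈ U ∩ unitDisk := ⟨h2, liftThrough_mem (hgood _ h1).2⟩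
    have h6 : s (t * z₀) = (eulerLogDeriv F (t * z₀))⁻¹ :=
      eq_inv_of_mul_eq_one_right (hqs' _ h4 h1)
    rw [hs0, sub_zero, h6, norm_inv] at h3
    have h7 : -(β : ℂ) * L (liftThrough F Q (t * z₀)) =
        ((β : ℝ) : ℂ) * -L (liftThrough F Q (t * z₀)) := by ring
    rw [hgL _ h5, h7, norm_cexp_ofReal_mul, Complex.exp_neg, hL.2 _ h5,
      map_liftThrough (hgood _ h1).2, norm_inv]
    exact Real.rpow_le_rpow (by positivity) h3 (by linarith)

end Cases

/-! ### The bad point of least modulus -/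

section Main

variable {a b c : ℂ} {Q : ℂ → ℂ} {E : Finset ℂ} (hc : ∀ n : ℕ, c ≠ -(n : ℂ))
  (hQ : IsAdmissible Q E)
  (h₁ : ∀ ζ : ℂ, ‖ζ‖ = 1 → ζ ∉ E →
    0 < -2 * (((a + b + 1 - c) * Q ζ + a * b) * conj (ζ * deriv Q ζ)).re)
  (h₂ : ∀ ζ : ℂ, ‖ζ‖ = 1 → ζ ∉ E →
    ‖(Q ζ + a) * (Q ζ + b)‖ ^ 2 - ‖Q ζ * (Q ζ + c - 1)‖ ^ 2 ≤
      -2 * (((a + b + 1 - c) * Q ζ + a * b) * conj (ζ * deriv Q ζ)).re)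

include hc hQ h₁ h₂

theorem eulerLogDeriv_mem_image_of_forall_ball {F : ℂ → ℂ}
    (hF : F = ordinaryHypergeometric a b c) {z₀ : ℂ} {r : ℝ} (hr : 0 < r) (hr1 : r < 1)
    (hz₀ : ‖z₀‖ = r)
    (hgood : ∀ z ∈ ball (0 : ℂ) r, F z ≠ 0 ∧ eulerLogDeriv F z ∈ Q '' unitDisk) :
    F z₀ ≠ 0 ∧ eulerLogDeriv F z₀ ∈ Q '' unitDisk := by
  have hFa : AnalyticOnNhd ℂ F unitDisk := hF ▸ analyticOnNhd_ordinaryHypergeometric hc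
  have hF0 : F 0 = 1 := by rw [hF]; exact ordinaryHypergeometric_zero a b c
  have hQu := hQ.univalentOn_unitDisk
  have hz₀D : z₀ ∈ unitDisk := by rw [mem_ball_zero_iff, hz₀]; exact hr1
  have hz₀0 : z₀ ≠ 0 := norm_pos_iff.1 (hz₀ ▸ hr)
  -- The radial limit of ω need not exist a priori; along an ultrafilter, compactness of the closed
  -- disk supplies one.
  obtain ⟨l, hl⟩ := Ultrafilter.exists_le (𝓝[<] (1 : ℝ))
  obtain ⟨ζ, hζ, hlim⟩ := (isCompact_closedBall (0 : ℂ) 1).ultrafilter_le_nhds'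
    (l.map fun t : ℝ => liftThrough F Q (t * z₀)) ((eventually_ofReal_mul_mem_ball hr hz₀ hl).mono fun t ht => by
      exact ball_subset_closedBall (liftThrough_mem (hgood _ ht).2))
  replace hlim : Tendsto (fun t : ℝ => liftThrough F Q (t * z₀)) l (𝓝 ζ) := hlim
  have hfin : AnalyticAt ℂ Q ζ → F z₀ ≠ 0 ∧ eulerLogDeriv F z₀ = Q ζ := fun h =>
    ne_zero_of_tendsto_eulerLogDeriv hFa hF0 hz₀D hz₀0 hl
      (tendsto_eulerLogDeriv_of_tendsto hr hz₀ hgood hl hlim h.continuousAt.continuousWithinAt)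
  rcases (mem_closedBall_zero_iff.1 hζ).lt_or_eq with hζ1 | hζ1
  · have hζD : ζ ∈ unitDisk := mem_ball_zero_iff.2 hζ1
    obtain ⟨h3, h4⟩ := hfin (hQu.1 ζ hζD)
    exact ⟨h3, ζ, hζD, h4.symm⟩
  exfalso
  by_cases hE : ζ ∈ E
  · rcases hQ.corner ζ hE with h | h
    · exact not_hasFiniteCorner hFa hF0 hr hr1 hz₀ hQu hQ.map_zero hgood hl hlim hζ1 h
    · exact not_hasInfiniteCorner hFa hF0 hr hr1 hz₀ hQu hQ.map_zero hgood hl hlim hζ1 h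
  · have hQζ := hQ.analyticAt_of_norm_eq_one hζ1 hE
    obtain ⟨h3, h4⟩ := hfin hQζ
    have h5 := h₁ ζ hζ1 hE
    have h6 := h₂ ζ hζ1 hE
    have hd : deriv Q ζ ≠ 0 := by
      intro h
      simp [h] at h5
    obtain ⟨m, hm, hmeq⟩ := exists_one_le_deriv_comp_eq hr hz₀
      (analyticOnNhd_liftThrough hFa hr1.le hQu hgood)
      (norm_liftThrough_le hFa hr1.le hQu hgood hQ.map_zero) hl hlim hζ1 hQζ hd
      (analyticAt_eulerLogDeriv (hFa z₀ hz₀D) h3) univ_mem univ_mem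
      fun z hz _ => (map_liftThrough (hgood z hz.2).2).symm
    have hric := eulerLogDeriv_ordinaryHypergeometric_riccati hc hF hz₀D h3
    rw [hmeq, h4] at hric
    -- The factor pQ + ab in the hypotheses is B - A.
    have hBA : (Q ζ + a) * (Q ζ + b) - Q ζ * (Q ζ + c - 1) = (a + b + 1 - c) * Q ζ + a * b := by
      ring
    rw [← hBA] at h5 h6
    exact false_of_boundary_inequality hm (by rw [hz₀]; exact hr1) hric h5 h6

theorem eulerLogDeriv_mem_image {F : ℂ → ℂ} (hF : F = ordinaryHypergeometric a b c) :
    ∀ z ∈ unitDisk, F z ≠ 0 ∧ eulerLogDeriv F z ∈ Q '' unitDisk := by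
  have hFa : AnalyticOnNhd ℂ F unitDisk := hF ▸ analyticOnNhd_ordinaryHypergeometric hc
  have hF0 : F 0 = 1 := by rw [hF]; exact ordinaryHypergeometric_zero a b c
  have hQu := hQ.univalentOn_unitDisk
  set G : Set ℂ := {z | z ∈ unitDisk ∧ F z ≠ 0 ∧ eulerLogDeriv F z ∈ Q '' unitDisk} with hG
  have hGo : IsOpen G := by
    rw [isOpen_iff_mem_nhds]
    rintro z ⟨h1, h2, h3⟩
    filter_upwards [isOpen_ball.mem_nhds h1, (hFa z h1).continuousAt.eventually_ne h2,
      (analyticAt_eulerLogDeriv (hFa z h1) h2).continuousAt.eventually_mem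
        ((isOpen_image_of_univalentOn isOpen_ball hQu).mem_nhds h3)] with w h4 h5 h6
    exact ⟨h4, h5, h6⟩
  by_contra! hbad
  obtain ⟨z₁, hz₁, hbad₁⟩ := hbad
  have hz₁G : z₁ ∉ G := fun h => hbad₁ h.2.1 h.2.2
  obtain ⟨z₀, ⟨hz₀1, hz₀G⟩, hmin⟩ := ((isCompact_closedBall (0 : ℂ) ‖z₁‖).inter_right
    hGo.isClosed_compl).exists_isMinOn ⟨z₁, by simp, hz₁G⟩ continuous_norm.continuousOn
  rw [mem_closedBall_zero_iff] at hz₀1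
  have hz₀lt : ‖z₀‖ < 1 := hz₀1.trans_lt (mem_ball_zero_iff.1 hz₁)
  have hball : ∀ z ∈ ball (0 : ℂ) ‖z₀‖, z ∈ G := by
    intro z hz
    rw [mem_ball_zero_iff] at hz
    by_contra h
    exact (isMinOn_iff.1 hmin z ⟨by simpa using (hz.le.trans hz₀1), h⟩).not_gt hz
  have hz₀pos : 0 < ‖z₀‖ := by
    refine norm_pos_iff.2 fun h => hz₀G ?_
    rw [h]
    exact ⟨by simp, by simp [hF0], 0, by simp, by rw [hQ.map_zero, eulerLogDeriv_zero]⟩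
  exact hz₀G ⟨by simpa using hz₀lt, eulerLogDeriv_mem_image_of_forall_ball hc hQ h₁ h₂ hF hz₀pos
    hz₀lt rfl fun z hz => (hball z hz).2⟩

end Main

end ShiftedGauss

theorem mainTheorem1 (a b c : ℂ) (hc : ∀ n : ℕ, c ≠ -(n : ℂ))
    (Q : ℂ → ℂ) (E : Finset ℂ) (hQ : ShiftedGauss.IsAdmissible Q E)
    (h₁ : ∀ ζ : ℂ, ‖ζ‖ = 1 → ζ ∉ E →
      0 < -2 * (((a + b + 1 - c) * Q ζ + a * b) * conj (ζ * deriv Q ζ)).re)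
    (h₂ : ∀ ζ : ℂ, ‖ζ‖ = 1 → ζ ∉ E →
      ‖(Q ζ + a) * (Q ζ + b)‖ ^ 2 - ‖Q ζ * (Q ζ + c - 1)‖ ^ 2 ≤
        -2 * (((a + b + 1 - c) * Q ζ + a * b) * conj (ζ * deriv Q ζ)).re) :
    (fun z : ℂ => z * ordinaryHypergeometric a b c z) ∈
      ShiftedGauss.starClass (fun z => 1 + Q z) := by
  open ShiftedGauss in
  obtain ⟨F, hF⟩ : ∃ F : ℂ → ℂ, F = ordinaryHypergeometric a b c := ⟨_, rfl⟩
  have hFa : AnalyticOnNhd ℂ F unitDisk := hF ▸ analyticOnNhd_ordinaryHypergeometric hc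
  have hF0 : F 0 = 1 := by rw [hF]; exact ordinaryHypergeometric_zero a b c
  have hgood := eulerLogDeriv_mem_image hc hQ h₁ h₂ hF
  have hQu := hQ.univalentOn_unitDisk
  rw [← hF]
  have hder : ∀ z ∈ unitDisk, deriv (fun z => z * F z) z = F z + z * deriv F z := by
    intro z hz
    have := ((hasDerivAt_id z).fun_mul (hFa z hz).differentiableAt.hasDerivAt).deriv
    simpa using this
  refine ⟨⟨fun z hz => analyticAt_id.mul (hFa z hz), by simp, ?_⟩, ?_, liftThrough F Q,
    analyticOnNhd_liftThrough hFa le_rfl hQu hgood, ?_, ?_⟩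
  · rw [hder 0 (by simp), hF0]; simp
  · exact fun z hz hz0 => mul_ne_zero hz0 (hgood z hz).1
  · intro z hz
    simpa using norm_liftThrough_le hFa le_rfl hQu hgood hQ.map_zero z hz
  · intro z hz
    rcases eq_or_ne z 0 with rfl | hz0
    · rw [Function.update_self]
      beta_reduce
      rw [liftThrough_zero hQu hQ.map_zero, hQ.map_zero, add_zero]
    · have hFz := (hgood z hz).1
      rw [Function.update_of_ne hz0]
      beta_reduce
      rw [map_liftThrough (hgood z hz).2, hder z hz, eulerLogDeriv]
      field_simp
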